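/- Let $p$ be a prime, let $k$ be an algebraically closed field of characteristic $p$, and let $G$ be a finite group. A finite-dimensional $kG$-module $M$ is called endotrivial if $M \otimes_k M^{*} \cong k \oplus P$ as $kG$-modules, where $k$ is the trivial module and $P$ is a projective $kG$-module. A component of $G$ is a subnormal subgroup $L$ that is quasi-simple, that is, $L$ is perfect and $L/Z(L)$ is simple. Let $V$ be a simple endotrivial $kG$-module and let $N$ be a subnormal subgroup of $G$ whose order is divisible by $p$. Then the restriction $\mathrm{Res}^{G}_{N}(V)$ is a simple $kN$-module. If, moreover, $N$ is a component of $G$, $V$ is faithful and $\dim_k V > 1$, then $C_G(N) = Z(G)$, and $N$ is the unique component of $G$. -/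

import Mathlib

open scoped MonoidAlgebra

universe u v w

/-- A finite-dimensional `kG`-module `V`, given as a representation `ρ`, is endotrivial if
`V ⊗ V* ≅ k ⊕ P` as `kG`-modules, with `k` the trivial module and `P` projective. -/
def Representation.IsEndotrivial {k : Type u} {G : Type w} {V : Type v} [Field k] [Group G]
    [AddCommGroup V] [Module k V] (ρ : Representation k G V) : Prop :=
  FiniteDimensional k V ∧
    ∃ (P : Type (max u v)) (_ : AddCommGroup P) (_ : Module k P) (σ : Representation k G P),
      Module.Projective k[G] σ.asModule ∧
      Nonempty ((ρ.tprod ρ.dual).Equiv ((Representation.trivial k G k).prod σ))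

/-- A group is quasi-simple if it is perfect and its quotient by its centre is simple. -/
def IsQuasisimpleGroup (L : Type w) [Group L] : Prop :=
  Group.IsPerfect L ∧ IsSimpleGroup (L ⧸ Subgroup.center L)

/-- A component of a group is a quasi-simple subnormal subgroup. -/
def Subgroup.IsComponent {G : Type w} [Group G] (L : Subgroup G) : Prop :=
  L.IsSubnormal ∧ IsQuasisimpleGroup L

/-!
Let `H ≤ G` have order zero in `k`. The traces `∑ h, h f h⁻¹` of `k`-linear endomorphisms `f` of `V`
form an ideal `I` in `E = End_{kH}(V)`. As `V` is endotrivial, `End_k(V)` is the sum of the trivial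
module and a projective one; traces vanish on the former and hit every invariant of the latter, so
`I` is a hyperplane and `E = k ⊕ I`.

Suppose that `V` is simple over some `K` normalizing `H`. Then `V` is semisimple over `H` by
Clifford's theorem, and the common kernel of the traces is `K`-stable, hence `0` or `V`. If it is
`0`, then `I` is generated by an injective idempotent, so `I = E`, a contradiction. So it is `V`,
that is, `I = 0` and `E = k`, and `V` is simple over `H`. Descending a subnormal series gives the
first claim.

For `H = K = N` this also shows that an element of `G` centralizing `N` acts on `V` as a scalar, so
it is central when `V` is faithful. Distinct components commute, and a component is not central.
-/

section Components

theorem IsQuasisimpleGroup.eq_top_or_le_center {L : Type*} [Group L] (hL : IsQuasisimpleGroup L)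
    (M : Subgroup L) [M.Normal] : M = ⊤ ∨ M ≤ Subgroup.center L := by
  obtain ⟨_, _⟩ := hL
  have hM : (M.map (QuotientGroup.mk' (Subgroup.center L))).Normal :=
    Subgroup.Normal.map inferInstance _ (QuotientGroup.mk'_surjective _)
  rcases hM.eq_bot_or_eq_top with hbot | htop
  · right
    rwa [Subgroup.map_eq_bot_iff, QuotientGroup.ker_mk'] at hbot
  · left
    have hcenter : Subgroup.center (L ⧸ M) = ⊤ := by
      refine (Subgroup.eq_top_iff' _).2 fun x ↦ Subgroup.mem_center_iff.2 fun y ↦ ?_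
      induction x using QuotientGroup.induction_on with | H x
      induction y using QuotientGroup.induction_on with | H y
      obtain ⟨m, hm, hmx⟩ := htop.ge (Subgroup.mem_top (x : L ⧸ Subgroup.center L))
      have hz : m⁻¹ * x ∈ Subgroup.center L := QuotientGroup.eq.1 hmx
      have hx : ((m⁻¹ * x : L) : L ⧸ M) = x := by
        rw [QuotientGroup.mk_mul, (QuotientGroup.eq_one_iff _).2 (M.inv_mem hm), one_mul]
      rw [← hx, ← QuotientGroup.mk_mul, Subgroup.mem_center_iff.1 hz y, QuotientGroup.mk_mul]
    have : IsMulCommutative (L ⧸ M) := Subgroup.center_eq_top_iff.1 hcenter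
    exact QuotientGroup.subsingleton_iff.1 inferInstance

open Subgroup

variable {G : Type*} [Group G]

theorem commutator_eq_bot_of_commutator_commutator_eq_bot {H N : Subgroup G} [Group.IsPerfect N]
    (h : ⁅⁅H, N⁆, N⁆ = ⊥) : ⁅H, N⁆ = ⊥ := by
  have hcomm : ⁅⁅N, H⁆, N⁆ = ⊥ := by rwa [commutator_comm N H]
  simpa only [commutator_eq_self, commutator_comm N H] using
    commutator_commutator_eq_bot_of_rotate hcomm h

theorem commutator_eq_bot_of_commutator_inf_eq_bot {N H K : Subgroup G} [Group.IsPerfect N]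
    (hK : K.IsSubnormal) (hNK : N ≤ K) (hNH : N ≤ normalizer (H : Set G)) (h : ⁅H ⊓ K, N⁆ = ⊥) :
    ⁅H, N⁆ = ⊥ := by
  induction hK with
  | top => simpa only [inf_top_eq] using h
  | step K K' hle _ hn ih =>
    rw [normal_subgroupOf_iff_le_normalizer hle, le_normalizer_iff_commutator_le_left] at hn
    refine ih (hNK.trans hle) (commutator_eq_bot_of_commutator_commutator_eq_bot ?_)
    have hleH : ⁅H ⊓ K', N⁆ ≤ H :=
      (commutator_mono inf_le_left le_rfl).trans (le_normalizer_iff_commutator_le_left.1 hNH)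
    have hleK : ⁅H ⊓ K', N⁆ ≤ K := by
      rw [commutator_comm]
      exact (commutator_mono hNK inf_le_right).trans hn
    exact eq_bot_iff.2 ((commutator_mono (le_inf hleH hleK) le_rfl).trans h.le)

namespace Subgroup.IsComponent

theorem le_or_commutator_eq_bot_of_le_normalizer {N H : Subgroup G}
    (hN : N.IsComponent) (hNH : N ≤ normalizer (H : Set G)) : N ≤ H ∨ ⁅H, N⁆ = ⊥ := by
  have := hN.2.1
  have hnormal : (H.subgroupOf N).Normal := normal_subgroupOf_of_le_normalizer hNH
  refine (hN.2.eq_top_or_le_center (H.subgroupOf N)).imp subgroupOf_eq_top.1 fun hcenter ↦ ?_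
  refine commutator_eq_bot_of_commutator_inf_eq_bot hN.1 le_rfl hNH ?_
  rw [commutator_eq_bot_iff_le_centralizer]
  intro x hx
  have hxN : (⟨x, hx.2⟩ : N) ∈ center N := hcenter (mem_subgroupOf.2 hx.1)
  exact mem_centralizer_iff.2 fun y hy ↦
    congrArg Subtype.val (mem_center_iff.1 hxN ⟨y, hy⟩)

theorem le_or_commutator_eq_bot {N U : Subgroup G} (hN : N.IsComponent)
    (hU : U.IsSubnormal) : N ≤ U ∨ ⁅U, N⁆ = ⊥ := by
  induction hU with
  | top => exact Or.inl le_top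
  | step U K hle _ hn ih =>
    rw [normal_subgroupOf_iff_le_normalizer hle] at hn
    rcases ih with hNK | hbot
    · exact hN.le_or_commutator_eq_bot_of_le_normalizer (hNK.trans hn)
    · exact Or.inr (eq_bot_iff.2 ((commutator_mono hle le_rfl).trans hbot.le))

theorem commutator_eq_bot_of_ne {N L : Subgroup G} (hN : N.IsComponent)
    (hL : L.IsComponent) (hne : L ≠ N) : ⁅L, N⁆ = ⊥ := by
  rcases hN.le_or_commutator_eq_bot hL.1 with hNL | hbot
  · rcases hL.le_or_commutator_eq_bot hN.1 with hLN | hbot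
    · exact absurd (le_antisymm hLN hNL) hne
    · rwa [commutator_comm]
  · exact hbot

theorem not_le_center {L : Subgroup G} (hL : L.IsComponent) : ¬ L ≤ center G := by
  intro h
  have := hL.2.2.toNontrivial
  refine QuotientGroup.nontrivial_iff.1 this (eq_top_iff.2 fun x _ ↦ mem_center_iff.2 fun y ↦ ?_)
  exact Subtype.ext (mem_center_iff.1 (h x.2) y)

end Subgroup.IsComponent

end Components

section Norm

open Representation (single_smul)

variable {k G V : Type*} [CommRing k] [Group G] [AddCommGroup V] [Module k V]

theorem norm_apply_eq_sum [Fintype G] (τ : Representation k G V) (v : V) :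
    τ.norm v = ∑ g, τ g v := by
  simp only [Representation.norm, LinearMap.sum_apply]

theorem norm_linHom_self_apply [Fintype G] (τ : Representation k G V) (f : Module.End k V) :
    (τ.linHom τ).norm f = ∑ g, τ g * f * τ g⁻¹ := by
  rw [norm_apply_eq_sum]
  rfl

theorem mul_norm_linHom_self [Fintype G] {τ : Representation k G V} {φ : Module.End k V}
    (hφ : ∀ g, Commute φ (τ g)) (f : Module.End k V) :
    φ * (τ.linHom τ).norm f = (τ.linHom τ).norm (φ * f) := by
  simp only [norm_linHom_self_apply, Finset.mul_sum, ← mul_assoc, (hφ _).eq]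

theorem norm_comp_subtype_apply_of_mem_normalizer (τ : Representation k G V) {H : Subgroup G}
    [Fintype H] {g : G} (hg : g ∈ Subgroup.normalizer (H : Set G)) (v : V) :
    Representation.norm (τ.comp H.subtype) (τ g v) =
      τ g (Representation.norm (τ.comp H.subtype) v) := by
  let conj : H ≃* H := H.normalizerMonoidHom ⟨g, hg⟩
  have hconj (h : H) : (conj h : G) * g = g * h := by simp [conj]
  calc Representation.norm (τ.comp H.subtype) (τ g v)
      = ∑ h : H, τ (h * g : G) v := by
        simp only [norm_apply_eq_sum, map_mul, Module.End.mul_apply]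
        rfl
    _ = ∑ h : H, τ (conj h * g : G) v := (conj.toEquiv.sum_comp fun h : H ↦ τ (h * g : G) v).symm
    _ = ∑ h : H, τ g (τ h v) := by simp only [hconj, map_mul, Module.End.mul_apply]
    _ = τ g (Representation.norm (τ.comp H.subtype) v) := by
        simp only [norm_apply_eq_sum, map_sum]
        rfl

theorem apply_mem_iInf_ker_norm_linHom {τ : Representation k G V} {H : Subgroup G}
    [Fintype H] {g : G} (hg : g ∈ Subgroup.normalizer (H : Set G)) {v : V}
    (hv : v ∈ ⨅ f, LinearMap.ker
      (Representation.norm ((τ.linHom τ).comp H.subtype) f : Module.End k V)) :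
    τ g v ∈ ⨅ f, LinearMap.ker
      (Representation.norm ((τ.linHom τ).comp H.subtype) f : Module.End k V) := by
  simp only [Submodule.mem_iInf, LinearMap.mem_ker] at hv ⊢
  intro f
  obtain ⟨f, rfl⟩ := ((τ.linHom τ).apply_bijective g).2 f
  rw [norm_comp_subtype_apply_of_mem_normalizer _ hg, Representation.linHom_apply]
  simp only [LinearMap.comp_apply, Representation.inv_self_apply, hv, map_zero]

theorem range_norm_le_range_norm_comp_subtype [Fintype G] (τ : Representation k G V)
    (H : Subgroup G) [Fintype H] :
    LinearMap.range τ.norm ≤ LinearMap.range (Representation.norm (τ.comp H.subtype)) := by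
  obtain ⟨T, hT, -⟩ := H.exists_isComplement_right 1
  have := Fintype.ofFinite T
  rintro _ ⟨v, rfl⟩
  refine ⟨∑ t : T, τ t v, ?_⟩
  calc Representation.norm (τ.comp H.subtype) (∑ t : T, τ t v)
      = ∑ h : H, τ h (∑ t : T, τ t v) := norm_apply_eq_sum _ _
    _ = ∑ x : H × T, τ (x.1 * x.2 : G) v := by
        simp only [Fintype.sum_prod_type, map_sum, map_mul, Module.End.mul_apply]
    _ = ∑ g : G, τ g v := hT.equiv.symm.sum_comp fun g ↦ τ g v
    _ = τ.norm v := (norm_apply_eq_sum τ v).symm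

-- The coefficient at `1` of `g⁻¹ a` is the coefficient of `a` at `g`, so averaging the
-- coefficients at `1` of a splitting of a free cover over the group gives the identity.
theorem exists_norm_linHom_self_eq_one_of_projective [Fintype G] (σ : Representation k G V)
    [hσ : Module.Projective k[G] σ.asModule] : ∃ f, (σ.linHom σ).norm f = 1 := by
  classical
  obtain ⟨s, hs⟩ := hσ.out
  let coeffOne : (σ.asModule →₀ k[G]) →ₗ[k] σ.asModule :=
    Finsupp.linearCombination k id ∘ₗ
      Finsupp.mapRange.linearMap
        (Finsupp.lapply 1 ∘ₗ (MonoidAlgebra.coeffLinearEquiv k).toLinearMap)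
  have hcoeffOne (z : σ.asModule →₀ k[G]) :
      ∑ g : G, MonoidAlgebra.single g (1 : k) • coeffOne (MonoidAlgebra.single g⁻¹ (1 : k) • z) =
        Finsupp.linearCombination k[G] id z := by
    induction z using Finsupp.induction_linear with
    | zero => simp
    | add z w hz hw => simp only [smul_add, map_add, Finset.sum_add_distrib, hz, hw]
    | single x a =>
      induction a using MonoidAlgebra.induction_linear with
      | zero => simp
      | add a b ha hb =>
        simp only [Finsupp.single_add, smul_add, map_add, Finset.sum_add_distrib, ha, hb]
      | single h c =>
        have hsingle (g : G) : coeffOne (MonoidAlgebra.single g⁻¹ (1 : k) •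
            Finsupp.single x (MonoidAlgebra.single h c)) = if g = h then c • x else 0 := by
          split_ifs with hgh
          · simp [coeffOne, hgh]
          · simp [coeffOne, inv_mul_eq_one, hgh]
        simp only [hsingle, smul_ite, smul_zero, Finset.sum_ite_eq', Finset.mem_univ, if_true]
        rw [Finsupp.linearCombination_single, id, smul_comm, ← smul_assoc,
          MonoidAlgebra.smul_single, smul_eq_mul, mul_one]
  refine ⟨coeffOne ∘ₗ s.restrictScalars k, LinearMap.ext fun x : σ.asModule ↦ ?_⟩
  have hx : ∑ g : G, MonoidAlgebra.single g (1 : k) •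
      coeffOne (s (MonoidAlgebra.single g⁻¹ (1 : k) • x)) = x := by
    simp only [map_smul, hcoeffOne, hs x]
  simp only [single_smul, one_smul] at hx
  rw [norm_linHom_self_apply]
  exact (LinearMap.sum_apply _ _ _).trans hx

theorem invariants_le_range_norm [Fintype G] (σ : Representation k G V)
    (hσ : ∃ f, (σ.linHom σ).norm f = 1) : σ.invariants ≤ LinearMap.range σ.norm := by
  obtain ⟨f, hf⟩ := hσ
  intro v hv
  refine ⟨f v, ?_⟩
  calc σ.norm (f v) = ∑ g, σ g (f (σ g⁻¹ v)) := by simp only [norm_apply_eq_sum, hv _]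
    _ = (σ.linHom σ).norm f v := by
      simp only [norm_linHom_self_apply, LinearMap.sum_apply, Module.End.mul_apply]
    _ = v := by rw [hf, Module.End.one_apply]

theorem invariants_comp_subtype_le_range_norm_of_projective [Finite G] (σ : Representation k G V)
    [Module.Projective k[G] σ.asModule] (H : Subgroup G) [Fintype H] :
    Representation.invariants (σ.comp H.subtype) ≤
      LinearMap.range (Representation.norm (σ.comp H.subtype)) := by
  have := Fintype.ofFinite G
  exact invariants_le_range_norm _ <| range_norm_le_range_norm_comp_subtype (σ.linHom σ) H <|
    exists_norm_linHom_self_eq_one_of_projective σ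

end Norm

section EndomorphismRing

theorem ideal_moduleEnd_eq_top_of_forall_apply_eq_zero {R M : Type*} [Ring R] [AddCommGroup M]
    [Module R M] [IsSemisimpleModule R M] [Module.Finite R M] (I : Ideal (Module.End R M))
    (hI : ∀ x, (∀ φ ∈ I, φ x = 0) → x = 0) : I = ⊤ := by
  have := IsSemisimpleRing.moduleEnd R M
  obtain ⟨e, he, rfl⟩ := IsSemisimpleRing.ideal_eq_span_idempotent I
  have hker (x : M) (hx : e x = 0) : x = 0 := hI x fun φ hφ ↦ by
    obtain ⟨ψ, rfl⟩ := Ideal.mem_span_singleton'.1 hφ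
    rw [Module.End.mul_apply, hx, map_zero]
  have heq_one : e = 1 := LinearMap.ext fun x ↦ sub_eq_zero.1 <| hker _ <| by
    rw [map_sub, ← Module.End.mul_apply, he.eq, Module.End.one_apply, sub_self]
  rw [heq_one, Ideal.span_singleton_one]

theorem isSimpleModule_of_forall_isIdempotentElem {R M : Type*} [Ring R] [AddCommGroup M]
    [Module R M] [IsSemisimpleModule R M] [Nontrivial M]
    (h : ∀ e : Module.End R M, IsIdempotentElem e → e = 0 ∨ e = 1) : IsSimpleModule R M := by
  refine isSimpleModule_iff _ _ |>.2 ⟨fun U ↦ ?_⟩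
  obtain ⟨W, hUW⟩ := exists_isCompl U
  rw [← Submodule.range_projection hUW]
  refine (h _ (Submodule.isIdempotentElem_projection hUW)).imp ?_ ?_
  · intro he
    rw [he, LinearMap.range_zero]
  · intro he
    rw [he, Module.End.one_eq_id, LinearMap.range_id]

open Representation

variable {k G V : Type*} [CommRing k] [Group G] [AddCommGroup V] [Module k V]

/-- The `k`-linear endomorphism of `V` underlying a `k[G]`-linear endomorphism of `ρ.asModule`. -/
noncomputable def underlyingEnd (ρ : Representation k G V) :
    Module.End k[G] ρ.asModule →ₐ[k] Module.End k V where
  toFun φ := ((IntertwiningMap.equivAlgEnd ρ).symm φ).toLinearMap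
  map_one' := rfl
  map_mul' _ _ := rfl
  map_zero' := rfl
  map_add' _ _ := rfl
  commutes' _ := rfl

theorem underlyingEnd_injective (ρ : Representation k G V) :
    Function.Injective (underlyingEnd ρ) :=
  (IntertwiningMap.toLinearMap_injective ρ ρ).comp (IntertwiningMap.equivAlgEnd ρ).symm.injective

theorem mem_range_underlyingEnd_iff {ρ : Representation k G V} {f : Module.End k V} :
    f ∈ Set.range (underlyingEnd ρ) ↔ f ∈ (ρ.linHom ρ).invariants := by
  refine .trans ?_ (mem_linHom_invariants_iff_isIntertwining f).symm
  constructor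
  · rintro ⟨φ, rfl⟩
    exact ⟨((IntertwiningMap.equivAlgEnd ρ).symm φ).isIntertwining⟩
  · exact fun hf ↦ ⟨IntertwiningMap.equivAlgEnd ρ
      (f.intertwiningMap_of_isIntertwiningMap ρ ρ hf.isIntertwining), rfl⟩

theorem commute_underlyingEnd {ρ : Representation k G V} (φ : Module.End k[G] ρ.asModule) (g : G) :
    Commute (underlyingEnd ρ φ) (ρ g) :=
  ((IntertwiningMap.equivAlgEnd ρ).symm φ).isIntertwining' g

/-- The traces `∑ g, g f g⁻¹` of the `k`-linear endomorphisms `f` of `V`, as a left ideal of the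
endomorphism ring of the `k[G]`-module `V`. -/
noncomputable def traceIdeal [Fintype G] (ρ : Representation k G V) :
    Ideal (Module.End k[G] ρ.asModule) where
  __ := ((LinearMap.range (ρ.linHom ρ).norm).comap (underlyingEnd ρ).toLinearMap).toAddSubmonoid
  smul_mem' ψ φ := by
    rintro ⟨f, hf⟩
    refine ⟨underlyingEnd ρ ψ * f, ?_⟩
    rw [← mul_norm_linHom_self (commute_underlyingEnd ψ), hf]
    exact (map_mul (underlyingEnd ρ) ψ φ).symm

theorem mem_traceIdeal_iff [Fintype G] {ρ : Representation k G V} {φ : Module.End k[G] ρ.asModule} :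
    φ ∈ traceIdeal ρ ↔ underlyingEnd ρ φ ∈ LinearMap.range (ρ.linHom ρ).norm := .rfl

theorem exists_mem_traceIdeal_underlyingEnd_eq [Fintype G] (ρ : Representation k G V)
    (f : Module.End k V) :
    ∃ φ ∈ traceIdeal ρ, underlyingEnd ρ φ = (ρ.linHom ρ).norm f := by
  obtain ⟨φ, hφ⟩ := mem_range_underlyingEnd_iff.2 fun g ↦ self_norm_apply (ρ.linHom ρ) g f
  exact ⟨φ, mem_traceIdeal_iff.2 ⟨f, hφ.symm⟩, hφ⟩

theorem traceIdeal_eq_bot_of_norm_eq_zero [Fintype G] {ρ : Representation k G V}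
    (h : (ρ.linHom ρ).norm = 0) : traceIdeal ρ = ⊥ := by
  refine (Submodule.eq_bot_iff _).2 fun φ hφ ↦ ?_
  rwa [mem_traceIdeal_iff, h, LinearMap.range_zero, Submodule.mem_bot,
    map_eq_zero_iff _ (underlyingEnd_injective ρ)] at hφ

theorem traceIdeal_eq_top_of_iInf_ker_eq_bot [Fintype G] [Module.Finite k V]
    {ρ : Representation k G V} [IsSemisimpleModule k[G] ρ.asModule]
    (h : ⨅ f, LinearMap.ker ((ρ.linHom ρ).norm f : Module.End k V) = ⊥) : traceIdeal ρ = ⊤ := by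
  have : Module.Finite k[G] ρ.asModule := .of_restrictScalars_finite k _ _
  refine ideal_moduleEnd_eq_top_of_forall_apply_eq_zero _ fun v hv ↦ ?_
  suffices hmem : ρ.asModuleEquiv v ∈ (⊥ : Submodule k V) from (Submodule.mem_bot k).1 hmem
  rw [← h, Submodule.mem_iInf]
  intro f
  obtain ⟨φ, hφ, hφf⟩ := exists_mem_traceIdeal_underlyingEnd_eq ρ f
  rw [← hφf]
  exact hv φ hφ

end EndomorphismRing

section Socle

variable (R M : Type*) [Ring R] [AddCommGroup M] [Module R M]

/-- The socle of a module, the sum of its simple submodules. -/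
def socle : Submodule R M :=
  sSup {U | IsSimpleModule R U}

variable {R M}

theorem map_socle_le (T : Submodule R M ≃o Submodule R M) : T (socle R M) ≤ socle R M := by
  rw [socle, T.map_sSup, iSup₂_le_iff]
  intro U hU
  apply le_sSup
  simp only [Set.mem_ofPred_eq, isSimpleModule_iff_isAtom] at hU ⊢
  exact (T.isAtom_iff U).2 hU

theorem socle_ne_bot [IsArtinian R M] [Nontrivial M] : socle R M ≠ ⊥ := by
  obtain ⟨U, hU⟩ := IsAtomic.exists_atom (Submodule R M)
  exact ne_bot_of_le_ne_bot hU.1 (le_sSup (isSimpleModule_iff_isAtom.2 hU))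

end Socle

section Translate

open Representation Subgroup

variable {k G V : Type*} [CommRing k] [Group G] [AddCommGroup V] [Module k V]
  (ρ : Representation k G V) {H : Subgroup G}

/-- Translation of `H`-subrepresentations by an element normalizing `H`. -/
def translateSubrepresentation (g : normalizer (H : Set G))
    (U : Subrepresentation (ρ.comp H.subtype)) : Subrepresentation (ρ.comp H.subtype) where
  toSubmodule := U.toSubmodule.map (ρ g)
  apply_mem_toSubmodule h := by
    rintro _ ⟨v, hv, rfl⟩
    have hconj : (g : G)⁻¹ * h * g ∈ H := by
      simpa using (mem_normalizer_iff.1 (inv_mem g.2) h).1 h.2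
    refine ⟨ρ ((g : G)⁻¹ * h * g) v, U.apply_mem_toSubmodule ⟨_, hconj⟩ hv, ?_⟩
    change ρ g (ρ ((g : G)⁻¹ * h * g) v) = ρ h (ρ g v)
    simp only [← Module.End.mul_apply, ← map_mul, mul_assoc, mul_inv_cancel_left]

theorem translateSubrepresentation_mul (g₁ g₂ : normalizer (H : Set G))
    (U : Subrepresentation (ρ.comp H.subtype)) :
    translateSubrepresentation ρ (g₁ * g₂) U =
      translateSubrepresentation ρ g₁ (translateSubrepresentation ρ g₂ U) := by
  apply Subrepresentation.toSubmodule_injective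
  simp only [translateSubrepresentation, coe_mul, map_mul]
  exact Submodule.map_comp (ρ g₂) (ρ g₁) U.toSubmodule

theorem translateSubrepresentation_one (U : Subrepresentation (ρ.comp H.subtype)) :
    translateSubrepresentation ρ 1 U = U := by
  apply Subrepresentation.toSubmodule_injective
  simp only [translateSubrepresentation, coe_one, map_one]
  exact Submodule.map_id U.toSubmodule

/-- Translation by an element normalizing `H`, as an automorphism of the lattice of
`H`-subrepresentations. -/
def translateOrderIso (g : normalizer (H : Set G)) :
    Subrepresentation (ρ.comp H.subtype) ≃o Subrepresentation (ρ.comp H.subtype) where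
  toFun := translateSubrepresentation ρ g
  invFun := translateSubrepresentation ρ g⁻¹
  left_inv U := by
    rw [← translateSubrepresentation_mul, inv_mul_cancel, translateSubrepresentation_one]
  right_inv U := by
    rw [← translateSubrepresentation_mul, mul_inv_cancel, translateSubrepresentation_one]
  map_rel_iff' := Submodule.map_le_map_iff_of_injective (ρ.apply_bijective _).1 _ _

theorem apply_mem_socle {g : G} (hg : g ∈ normalizer (H : Set G)) {v : V}
    (hv : v ∈ socle k[H] (asModule (ρ.comp H.subtype))) :
    ρ g v ∈ socle k[H] (asModule (ρ.comp H.subtype)) := by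
  let e : Subrepresentation (ρ.comp H.subtype) ≃o Submodule k[H] (asModule (ρ.comp H.subtype)) :=
    Subrepresentation.subrepresentationSubmoduleOrderIso
  have hmem : v ∈ (e.symm (socle k[H] (asModule (ρ.comp H.subtype)))).toSubmodule := hv
  exact map_socle_le (e.symm.trans ((translateOrderIso ρ ⟨g, hg⟩).trans e))
    (Submodule.mem_map_of_mem (f := ρ g) hmem)

end Translate

section Clifford

open Representation Subgroup

variable {k G V : Type*} [Field k] [Group G] [AddCommGroup V] [Module k V]
  (ρ : Representation k G V) {H K : Subgroup G}

theorem socle_asModule_ne_bot [FiniteDimensional k V] [Nontrivial V] :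
    socle k[G] ρ.asModule ≠ ⊥ := by
  have : Module.Finite k ρ.asModule := .equiv ρ.asModuleEquiv.symm
  have : IsArtinian k[G] ρ.asModule := isArtinian_of_tower k inferInstance
  have : Nontrivial ρ.asModule := ‹Nontrivial V›
  exact socle_ne_bot

theorem nontrivial_of_isIrreducible [ρ.IsIrreducible] : Nontrivial V := by
  by_contra h
  rw [not_nontrivial_iff_subsingleton] at h
  exact bot_ne_top (α := Subrepresentation ρ) (Subrepresentation.ext (Subsingleton.elim _ _))

variable {ρ} in
theorem eq_bot_or_eq_top_of_forall_apply_mem [ρ.IsIrreducible] (U : Submodule k V)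
    (hU : ∀ g, ∀ v ∈ U, ρ g v ∈ U) : U = ⊥ ∨ U = ⊤ :=
  (eq_bot_or_eq_top (⟨U, hU⟩ : Subrepresentation ρ)).imp
    (congrArg Subrepresentation.toSubmodule) (congrArg Subrepresentation.toSubmodule)

theorem isIrreducible_comp_subtype_top (hρ : ρ.IsIrreducible) :
    IsIrreducible (ρ.comp (⊤ : Subgroup G).subtype) := by
  have := nontrivial_of_isIrreducible ρ
  refine
    { exists_pair_ne := ⟨⊥, ⊤, fun h ↦ bot_ne_top (congrArg Subrepresentation.toSubmodule h)⟩
      eq_bot_or_eq_top U := ?_ }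
  exact (eq_bot_or_eq_top_of_forall_apply_mem (ρ := ρ) U.toSubmodule fun g _ hv ↦
    U.apply_mem_toSubmodule ⟨g, mem_top g⟩ hv).imp
      (fun h ↦ Subrepresentation.ext h) fun h ↦ Subrepresentation.ext h

theorem isSemisimpleModule_comp_subtype_of_le_normalizer [FiniteDimensional k V]
    (hK : K ≤ normalizer (H : Set G)) [IsIrreducible (ρ.comp K.subtype)] :
    IsSemisimpleModule k[H] (asModule (ρ.comp H.subtype)) := by
  have := nontrivial_of_isIrreducible (ρ.comp K.subtype)
  let S := Subrepresentation.ofSubmodule' (socle k[H] (asModule (ρ.comp H.subtype)))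
  have hS : S.toSubmodule = ⊥ ∨ S.toSubmodule = ⊤ :=
    eq_bot_or_eq_top_of_forall_apply_mem (ρ := ρ.comp K.subtype) _ fun g v hv ↦
      apply_mem_socle ρ (hK g.2) hv
  refine .of_sSup_simples_eq_top (Submodule.ext fun v ↦ ?_)
  rcases hS with h | h
  · refine absurd ?_ (socle_asModule_ne_bot (ρ.comp H.subtype))
    exact Submodule.ext fun v ↦ SetLike.ext_iff.1 h v
  · exact SetLike.ext_iff.1 h v

variable {ρ} in
theorem traceIdeal_eq_bot_or_eq_top_of_le_normalizer [FiniteDimensional k V] [Fintype H]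
    (hK : K ≤ normalizer (H : Set G)) [IsIrreducible (ρ.comp K.subtype)] :
    traceIdeal (ρ.comp H.subtype) = ⊥ ∨ traceIdeal (ρ.comp H.subtype) = ⊤ := by
  have := isSemisimpleModule_comp_subtype_of_le_normalizer ρ hK
  rcases eq_bot_or_eq_top_of_forall_apply_mem (ρ := ρ.comp K.subtype)
    (⨅ f, LinearMap.ker (norm ((ρ.linHom ρ).comp H.subtype) f : Module.End k V))
    fun g _ hv ↦ apply_mem_iInf_ker_norm_linHom (hK g.2) hv with h | h
  · exact .inr (traceIdeal_eq_top_of_iInf_ker_eq_bot h)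
  · refine .inl (traceIdeal_eq_bot_of_norm_eq_zero ?_)
    exact LinearMap.ext fun f ↦ LinearMap.ker_eq_top.1 (iInf_eq_top.1 h f)

end Clifford

section TrivialProd

open Representation

variable {k G V P : Type*} [CommRing k] [Group G] [Fintype G] [AddCommGroup V] [Module k V]
  [AddCommGroup P] [Module k P]

theorem map_norm_apply {τ : Representation k G V} {σ : Representation k G P}
    (f : IntertwiningMap τ σ) (v : V) : f (τ.norm v) = σ.norm (f v) := by
  simp only [norm_apply_eq_sum, map_sum, f.isIntertwining]

theorem norm_trivial_prod_apply (hG : (Nat.card G : k) = 0) (σ : Representation k G P) (x : k × P) :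
    ((trivial k G k).prod σ).norm x = (0, σ.norm x.2) := by
  rw [Nat.card_eq_fintype_card] at hG
  ext <;> simp [norm_apply_eq_sum, Prod.fst_sum, Prod.snd_sum, hG]

theorem mem_range_norm_iff_fst_eq_zero (hG : (Nat.card G : k) = 0) {τ : Representation k G V}
    {σ : Representation k G P} (hσ : σ.invariants ≤ LinearMap.range σ.norm)
    (e : τ.Equiv ((trivial k G k).prod σ)) {v : V} (hv : v ∈ τ.invariants) :
    v ∈ LinearMap.range τ.norm ↔ (e v).1 = 0 := by
  constructor
  · rintro ⟨w, rfl⟩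
    exact congrArg Prod.fst ((map_norm_apply e.toIntertwiningMap w).trans
      (norm_trivial_prod_apply hG σ _))
  · intro hfst
    have hsnd : (e v).2 ∈ σ.invariants := fun g ↦ by
      have hg := e.toIntertwiningMap.isIntertwining _ _ g v
      rw [hv g] at hg
      exact (congrArg Prod.snd hg).symm
    obtain ⟨y, hy⟩ := hσ hsnd
    refine ⟨e.symm (0, y), ?_⟩
    refine (map_norm_apply e.symm.toIntertwiningMap (0, y)).symm.trans ?_
    rw [norm_trivial_prod_apply hG, hy, ← hfst]
    exact e.symm_apply_apply v

variable {ρ : Representation k G V} {σ : Representation k G P}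

theorem exists_surjective_forall_mem_traceIdeal_iff (hG : (Nat.card G : k) = 0)
    (hσ : σ.invariants ≤ LinearMap.range σ.norm)
    (e : (ρ.linHom ρ).Equiv ((trivial k G k).prod σ)) :
    ∃ c : Module.End k[G] ρ.asModule →ₗ[k] k,
      Function.Surjective c ∧ ∀ φ, φ ∈ traceIdeal ρ ↔ c φ = 0 := by
  refine ⟨LinearMap.fst k k P ∘ₗ e.toLinearMap ∘ₗ (underlyingEnd ρ).toLinearMap,
    LinearMap.range_eq_top.1 <| (Ideal.eq_top_iff_one _).2 ?_, fun φ ↦ ?_⟩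
  · have hinv : e.symm (1, 0) ∈ (ρ.linHom ρ).invariants := fun g ↦ by
      refine (e.symm.toIntertwiningMap.isIntertwining _ _ g (1, 0)).symm.trans ?_
      simp
    obtain ⟨φ, hφ⟩ := mem_range_underlyingEnd_iff.2 hinv
    exact ⟨φ, by simp [hφ]⟩
  · exact mem_range_norm_iff_fst_eq_zero hG hσ e (mem_range_underlyingEnd_iff.1 ⟨φ, rfl⟩)

theorem traceIdeal_ne_top [Nontrivial k] (hG : (Nat.card G : k) = 0)
    (hσ : σ.invariants ≤ LinearMap.range σ.norm)
    (e : (ρ.linHom ρ).Equiv ((trivial k G k).prod σ)) : traceIdeal ρ ≠ ⊤ := by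
  obtain ⟨c, hc, hmem⟩ := exists_surjective_forall_mem_traceIdeal_iff hG hσ e
  obtain ⟨φ, hφ⟩ := hc 1
  intro htop
  exact one_ne_zero (hφ.symm.trans ((hmem φ).1 (htop ▸ Submodule.mem_top)))

end TrivialProd

section ScalarEndomorphism

open Representation

variable {k G V P : Type*} [Field k] [Group G] [Fintype G] [AddCommGroup V] [Module k V]
  [AddCommGroup P] [Module k P] {ρ : Representation k G V} {σ : Representation k G P}

theorem exists_sub_smul_one_mem_traceIdeal (hG : (Nat.card G : k) = 0)
    (hσ : σ.invariants ≤ LinearMap.range σ.norm)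
    (e : (ρ.linHom ρ).Equiv ((trivial k G k).prod σ)) (φ : Module.End k[G] ρ.asModule) :
    ∃ a : k, φ - a • 1 ∈ traceIdeal ρ := by
  obtain ⟨c, -, hmem⟩ := exists_surjective_forall_mem_traceIdeal_iff hG hσ e
  have hone : c 1 ≠ 0 := fun h ↦
    traceIdeal_ne_top hG hσ e ((Ideal.eq_top_iff_one _).2 ((hmem 1).2 h))
  refine ⟨c φ / c 1, (hmem _).2 ?_⟩
  rw [map_sub, map_smul, smul_eq_mul, div_mul_cancel₀ _ hone, sub_self]

theorem exists_eq_smul_one_of_traceIdeal_eq_bot (hG : (Nat.card G : k) = 0)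
    (hσ : σ.invariants ≤ LinearMap.range σ.norm)
    (e : (ρ.linHom ρ).Equiv ((trivial k G k).prod σ)) (hbot : traceIdeal ρ = ⊥)
    {f : Module.End k V} (hf : ∀ g, Commute f (ρ g)) : ∃ a : k, f = a • 1 := by
  have hinv : f ∈ (ρ.linHom ρ).invariants :=
    (mem_linHom_invariants_iff_isIntertwining f).2 ⟨fun g v ↦ LinearMap.congr_fun (hf g) v⟩
  obtain ⟨φ, rfl⟩ := mem_range_underlyingEnd_iff.2 hinv
  obtain ⟨a, ha⟩ := exists_sub_smul_one_mem_traceIdeal hG hσ e φ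
  rw [hbot, Submodule.mem_bot, sub_eq_zero] at ha
  exact ⟨a, by rw [ha, map_smul, map_one]⟩

end ScalarEndomorphism

namespace Representation.IsEndotrivial

open Subgroup

variable {k : Type u} {G : Type w} {V : Type v} [Field k] [Group G] [AddCommGroup V]
  [Module k V] {ρ : Representation k G V} {H K : Subgroup G}

theorem exists_equiv_linHom (hρ : ρ.IsEndotrivial) :
    ∃ (P : Type (max u v)) (_ : AddCommGroup P) (_ : Module k P) (σ : Representation k G P),
      Module.Projective k[G] σ.asModule ∧
      Nonempty ((ρ.linHom ρ).Equiv ((trivial k G k).prod σ)) := by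
  obtain ⟨_, P, _, _, σ, hσ, ⟨e⟩⟩ := hρ
  exact ⟨P, _, _, σ, hσ,
    ⟨(Equiv.dualTensorHom ρ ρ).symm.trans ((TensorProduct.comm ρ.dual ρ).trans e)⟩⟩

variable [Finite G]

theorem exists_equiv_linHom_comp_subtype (hρ : ρ.IsEndotrivial) (H : Subgroup G) [Fintype H] :
    ∃ (P : Type (max u v)) (_ : AddCommGroup P) (_ : Module k P) (σ : Representation k H P),
      σ.invariants ≤ LinearMap.range σ.norm ∧
      Nonempty ((linHom (ρ.comp H.subtype) (ρ.comp H.subtype)).Equiv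
        ((trivial k H k).prod σ)) := by
  obtain ⟨P, _, _, σ, hσ, ⟨e⟩⟩ := hρ.exists_equiv_linHom
  exact ⟨P, _, _, σ.comp H.subtype, invariants_comp_subtype_le_range_norm_of_projective σ H,
    ⟨.mk e.toLinearEquiv fun h ↦ e.isIntertwining' h⟩⟩

theorem exists_eq_smul_one_of_commute (hρ : ρ.IsEndotrivial)
    (hK : K ≤ normalizer (H : Set G)) [Representation.IsIrreducible (ρ.comp K.subtype)]
    (hH : (Nat.card H : k) = 0) {f : Module.End k V} (hf : ∀ h ∈ H, Commute f (ρ h)) :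
    ∃ a : k, f = a • 1 := by
  have := Fintype.ofFinite H
  have := hρ.1
  obtain ⟨P, _, _, σ, hσ, ⟨e⟩⟩ := hρ.exists_equiv_linHom_comp_subtype H
  have hbot : traceIdeal (ρ.comp H.subtype) = ⊥ :=
    (traceIdeal_eq_bot_or_eq_top_of_le_normalizer hK).resolve_right (traceIdeal_ne_top hH hσ e)
  exact exists_eq_smul_one_of_traceIdeal_eq_bot hH hσ e hbot fun h ↦ hf h h.2

theorem isIrreducible_comp_subtype_of_le_normalizer (hρ : ρ.IsEndotrivial)
    (hK : K ≤ normalizer (H : Set G)) [Representation.IsIrreducible (ρ.comp K.subtype)]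
    (hH : (Nat.card H : k) = 0) : Representation.IsIrreducible (ρ.comp H.subtype) := by
  have := hρ.1
  have := nontrivial_of_isIrreducible (ρ.comp K.subtype)
  have : Nontrivial (asModule (ρ.comp H.subtype)) := ‹Nontrivial V›
  have := isSemisimpleModule_comp_subtype_of_le_normalizer ρ hK
  refine (irreducible_iff_isSimpleModule_asModule _).2 <|
    isSimpleModule_of_forall_isIdempotentElem fun ε hε ↦ ?_
  obtain ⟨a, ha⟩ := hρ.exists_eq_smul_one_of_commute hK hH
    fun h hh ↦ commute_underlyingEnd ε ⟨h, hh⟩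
  have hidem : a * a = a := by
    refine smul_left_injective k (one_ne_zero (α := Module.End k V)) ?_
    simpa only [ha, smul_mul_smul_comm, mul_one] using (hε.map (underlyingEnd _)).eq
  refine (IsIdempotentElem.iff_eq_zero_or_one.1 hidem).imp ?_ ?_ <;> rintro rfl <;>
    refine underlyingEnd_injective _ (ha.trans ?_)
  · rw [zero_smul, map_zero]
  · rw [one_smul, map_one]

theorem isIrreducible_comp_subtype (hρ : ρ.IsEndotrivial) (hirr : ρ.IsIrreducible)
    (hH : H.IsSubnormal) (hcard : (Nat.card H : k) = 0) :
    Representation.IsIrreducible (ρ.comp H.subtype) := by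
  induction hH with
  | top => exact isIrreducible_comp_subtype_top ρ hirr
  | step H K hle _ hn ih =>
    have hK : (Nat.card K : k) = 0 := by
      obtain ⟨m, hm⟩ := card_dvd_of_le hle
      rw [hm, Nat.cast_mul, hcard, zero_mul]
    have := ih hK
    have hn := (normal_subgroupOf_iff_le_normalizer hle).1 hn
    exact hρ.isIrreducible_comp_subtype_of_le_normalizer hn hcard

theorem centralizer_eq_center (hρ : ρ.IsEndotrivial)
    [Representation.IsIrreducible (ρ.comp H.subtype)] (hH : (Nat.card H : k) = 0)
    (hinj : Function.Injective ρ) : centralizer (H : Set G) = center G := by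
  refine le_antisymm (fun z hz ↦ mem_center_iff.2 fun g ↦ hinj ?_) (center_le_centralizer _)
  obtain ⟨a, ha⟩ := hρ.exists_eq_smul_one_of_commute le_normalizer hH fun h hh ↦
    (show Commute z h from (mem_centralizer_iff.1 hz h hh).symm).map ρ
  rw [map_mul, map_mul, ha, mul_smul_comm, smul_mul_assoc, mul_one, one_mul]

end Representation.IsEndotrivial

theorem lemma2_general {k : Type u} [Field k] {G : Type w} [Group G] [Finite G] {V : Type v}
    [AddCommGroup V] [Module k V] (ρ : Representation k G V) (hend : ρ.IsEndotrivial)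
    (hsimple : ρ.IsIrreducible) (N : Subgroup G) (hN : N.IsSubnormal)
    (hp : (Nat.card N : k) = 0) :
    Representation.IsIrreducible (ρ.comp N.subtype) ∧
    (N.IsComponent → Function.Injective ρ →
      Subgroup.centralizer (N : Set G) = Subgroup.center G ∧
      ∀ L : Subgroup G, L.IsComponent → L = N) := by
  have hirr := hend.isIrreducible_comp_subtype hsimple hN hp
  refine ⟨hirr, fun hcomp hinj ↦ ?_⟩
  have hcentralizer := hend.centralizer_eq_center hp hinj
  refine ⟨hcentralizer, fun L hL ↦ by_contra fun hne ↦ hL.not_le_center ?_⟩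
  rw [← hcentralizer]
  exact Subgroup.commutator_eq_bot_iff_le_centralizer.1 (hcomp.commutator_eq_bot_of_ne hL hne)

theorem lemma2 {p : ℕ} [Fact p.Prime] {k : Type u} [Field k] [IsAlgClosed k] [CharP k p]
    {G : Type w} [Group G] [Finite G] {V : Type v} [AddCommGroup V] [Module k V]
    (ρ : Representation k G V) (hend : ρ.IsEndotrivial) (hsimple : ρ.IsIrreducible)
    (N : Subgroup G) (hN : N.IsSubnormal) (hp : p ∣ Nat.card N) :
    Representation.IsIrreducible (ρ.comp N.subtype) ∧
    (N.IsComponent → Function.Injective ρ → 1 < Module.finrank k V →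
      Subgroup.centralizer (N : Set G) = Subgroup.center G ∧
      ∀ L : Subgroup G, L.IsComponent → L = N) :=
  (lemma2_general ρ hend hsimple N hN ((CharP.cast_eq_zero_iff k p _).2 hp)).imp_right
    fun h hcomp hinj _ ↦ h hcomp hinj
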